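/- All graphs are finite, simple, undirected and connected. For a graph $G$ with vertex set $V$, let $d(u,v)$ be the length of a shortest path between $u$ and $v$, and for $s\in V$ and nonempty $X\subseteq V$ put $d(s,X)=\min_{x\in X}d(s,x)$. A nonempty set $S\subseteq V$ is a \emph{$1$-solid-resolving set} of $G$ if for all distinct nonempty sets $X,Y\subseteq V$ with $|X|\le 1$ (and $|Y|$ arbitrary) there is an $s\in S$ with $d(s,X)\ne d(s,Y)$. The \emph{$1$-solid-metric dimension} $\beta_1^s(G)$ is the minimum cardinality of a $1$-solid-resolving set of $G$. For odd $n\ge 5$, the \emph{flower snark} $J_n$ is the graph with the $4n$ vertices $a_i,b_i,c_i,d_i$ ($1\le i\le n$) whose edges are $b_ia_i$, $b_ic_i$, $b_id_i$ for $1\le i\le n$, the edges of the cycle $a_1a_2\cdots a_na_1$, and the edges of the cycle $c_1c_2\cdots c_nd_1d_2\cdots d_nc_1$. \textbf{Theorem.} For every odd integer $n\ge 5$, $\beta_1^s(J_n)=6$. -/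

import Mathlib

/-- The distance `d(s, X) = min_{x ∈ X} d(s, x)` from a vertex `s` to a vertex set `X`.
It is `⊤` when `X` is empty. -/
noncomputable def SimpleGraph.distToSet {V : Type*} (G : SimpleGraph V) (s : V) (X : Set V) : ℕ∞ :=
  ⨅ x ∈ X, G.edist s x

/-- The distance array of the vertex set `X` with respect to `S`, i.e. the family
`(d(s, X))` indexed by `s ∈ S`. -/
noncomputable def SimpleGraph.distArray {V : Type*} (G : SimpleGraph V) (S X : Set V) : S → ℕ∞ :=
  fun s => G.distToSet s X

/-- `S` is an `ℓ`-solid-resolving set of `G`: any two distinct nonempty vertex sets `X`, `Y`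
with `|X| ≤ ℓ` (and no restriction on `|Y|`) have different distance arrays with respect to the
nonempty set `S`. -/
def SimpleGraph.IsSolidResolving {V : Type*} (G : SimpleGraph V) (ℓ : ℕ) (S : Set V) : Prop :=
  S.Nonempty ∧ ∀ X Y : Set V, X.Nonempty → Y.Nonempty → X ≠ Y → X.encard ≤ ℓ →
    G.distArray S X ≠ G.distArray S Y

/-- The `ℓ`-solid-metric dimension of `G`: the minimum cardinality of an `ℓ`-solid-resolving set
(`⊤` if there is no finite one). -/
noncomputable def SimpleGraph.solidMetricDim {V : Type*} (G : SimpleGraph V) (ℓ : ℕ) : ℕ∞ :=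
  ⨅ S ∈ {S : Set V | G.IsSolidResolving ℓ S}, S.encard

/-- The four kinds of vertices in each star of a flower snark: `b` is the centre of the star,
and `a`, `c`, `d` are its leaves. -/
inductive FlowerKind : Type
  | a
  | b
  | c
  | d
  deriving DecidableEq

instance : Fintype FlowerKind where
  elems := {.a, .b, .c, .d}
  complete x := by cases x <;> simp

/-- The edges of the flower snark, each listed in one orientation. The star with index
`i : Fin n` (counted from `0`) has the vertices `(a, i)`, `(b, i)`, `(c, i)`, `(d, i)`. -/
def flowerSnarkRel (n : ℕ) : FlowerKind × Fin n → FlowerKind × Fin n → Prop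
  -- the stars `K_{1,3}`
  | (.b, i), (.a, j) => i = j
  | (.b, i), (.c, j) => i = j
  | (.b, i), (.d, j) => i = j
  -- the cycle `a_1 a_2 ... a_n a_1`
  | (.a, i), (.a, j) => i.val + 1 = j.val ∨ (i.val + 1 = n ∧ j.val = 0)
  -- the cycle `c_1 c_2 ... c_n d_1 d_2 ... d_n c_1`
  | (.c, i), (.c, j) => i.val + 1 = j.val
  | (.c, i), (.d, j) => i.val + 1 = n ∧ j.val = 0
  | (.d, i), (.d, j) => i.val + 1 = j.val
  | (.d, i), (.c, j) => i.val + 1 = n ∧ j.val = 0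
  | _, _ => False

/-- The flower snark `J_n` (meaningful for odd `n ≥ 5`), on `4 n` vertices. -/
def flowerSnark (n : ℕ) : SimpleGraph (FlowerKind × Fin n) :=
  SimpleGraph.fromRel (flowerSnarkRel n)

/-! Comparing `{y}` with `{x, y}` shows that `S` is 1-solid-resolving exactly when every ordered
pair of distinct vertices `x`, `y` has some `s ∈ S` strictly closer to `x`. With explicit distances,
each pair says which vertices can serve it, and the dimension becomes a hitting problem.

Call the `c`- and `d`-vertices rail vertices; they form a cycle of length `2n`. Write `n = 2m + 1`.
Lower bound: `S` needs an `a`-vertex (`exists_a_mem`). It needs three rail vertices, or two together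
with four `b`-vertices (`three_le_rail_or_four_le_b`), and four rail vertices if it has no
`b`-vertex (`four_le_rail_of_no_b`). So a set of fewer than six has exactly one `a`-vertex, rotated
to index `0`, and at most one `b`-vertex. Pairs of type `(a, b)` then force a `b`-vertex at index
`m` or `m + 1`, far from `0`, and `four_le_rail_of_b_middle` yields four rail vertices after all:
six in total.

Upper bound: `a_0`, `b_m` and the rail vertices with indices `1` and `m + 1` suffice
(`flowerSnark_separated`). The four rail vertices cut the rail cycle into arcs of lengths
alternately `m` and `m + 1`. -/

namespace SimpleGraph

variable {V : Type*} (G : SimpleGraph V)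

/-- `S` is `1`-solid-resolving iff for every ordered pair of distinct vertices, some element of
`S` is strictly closer to the first one. -/
theorem isSolidResolving_one_iff (S : Set V) :
    G.IsSolidResolving 1 S ↔
      S.Nonempty ∧ ∀ x y, x ≠ y → ∃ s ∈ S, G.edist s x < G.edist s y := by
  refine and_congr_right fun _ => ⟨fun h x y hxy => ?_, fun h X Y hX hY hXY hc harr => ?_⟩
  · have hne : ({y} : Set V) ≠ {x, y} := fun he => hxy (by
      have : x ∈ ({y} : Set V) := he ▸ Set.mem_insert x {y}
      simpa using this)
    have := h {y} {x, y} (Set.singleton_nonempty _) (Set.insert_nonempty _ _) hne (by simp)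
    obtain ⟨s, hs⟩ := Function.ne_iff.mp this
    refine ⟨s, s.2, ?_⟩
    by_contra hle
    apply hs
    simp only [distArray, distToSet, iInf_insert, iInf_singleton]
    exact (min_eq_right (not_lt.mp hle)).symm
  · have hX1 : X.encard = 1 :=
      le_antisymm (by simpa using hc) (Set.one_le_encard_iff_nonempty.mpr hX)
    obtain ⟨x, rfl⟩ := Set.encard_eq_one.mp hX1
    obtain ⟨y, hy, hyx⟩ : ∃ y ∈ Y, y ≠ x := by
      by_contra! hall
      exact hXY ((Set.eq_singleton_iff_nonempty_unique_mem.mpr ⟨hY, hall⟩).symm)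
    -- The order matters: an `s` closer to `y` than to `x` makes `d(s, Y)` smaller than `d(s, {x})`,
    -- whatever else `Y` contains.
    obtain ⟨s, hs, hlt⟩ := h y x hyx
    have he := congrFun harr ⟨s, hs⟩
    simp only [distArray, distToSet, iInf_singleton] at he
    exact absurd (iInf₂_le y hy) (not_le.mpr (he ▸ hlt))

/-- A function which vanishes only at `s`, is `1`-Lipschitz along edges, and decreases along some
edge at every other vertex is the distance from `s`. -/
theorem edist_eq_of_descent {s : V} (f : V → ℕ) (hs : f s = 0)
    (hlip : ∀ u v, G.Adj u v → f v ≤ f u + 1)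
    (hdesc : ∀ v, v ≠ s → ∃ u, G.Adj u v ∧ f u + 1 = f v) (v : V) :
    G.edist s v = f v := by
  apply le_antisymm
  · induction hk : f v generalizing v with
    | zero =>
      by_cases hv : v = s
      · simp [hv]
      · obtain ⟨u, -, hu⟩ := hdesc v hv
        omega
    | succ k ih =>
      have hv : v ≠ s := by rintro rfl; omega
      obtain ⟨u, huv, hu⟩ := hdesc v hv
      calc G.edist s v ≤ G.edist s u + G.edist u v := G.edist_triangle
        _ ≤ k + 1 := add_le_add (ih u (by omega)) (edist_eq_one_iff_adj.mpr huv).le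
        _ = ((k + 1 : ℕ) : ℕ∞) := by push_cast; rfl
  · have hwalk : ∀ {u w : V} (p : G.Walk u w), f w ≤ f u + p.length := by
      intro u w p
      induction p with
      | nil => simp
      | cons h p ih =>
        have := hlip _ _ h
        rw [Walk.length_cons]
        omega
    refine le_iInf fun p => ?_
    have := hwalk p
    rw [hs, zero_add] at this
    exact_mod_cast this

end SimpleGraph

/-! ### Distances in the flower snark in closed form -/

/-- The distance of `i` and `j` on the cycle of length `n`. -/
def cycleDist (n i j : ℕ) : ℕ := min ((i - j) + (j - i)) (n - ((i - j) + (j - i)))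

/-- The distance in `J_n` of the vertices `c_i` and `c_j` (or `d_i` and `d_j`). -/
def sameRailDist (n i j : ℕ) : ℕ := min ((i - j) + (j - i)) (n + 2 - ((i - j) + (j - i)))

/-- The distance in `J_n` of the vertices `c_i` and `d_j`. -/
def crossRailDist (n i j : ℕ) : ℕ := min (n - ((i - j) + (j - i))) ((i - j) + (j - i) + 2)

/-- The distance between two vertices of the flower snark `J_n`, `n` odd, in closed form. -/
def flowerSnarkDist (n : ℕ) (u v : FlowerKind × Fin n) : ℕ :=
  match u.1, v.1 with
  | .a, .a => cycleDist n u.2 v.2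
  | .a, .b => cycleDist n u.2 v.2 + 1
  | .a, .c => cycleDist n u.2 v.2 + 2
  | .a, .d => cycleDist n u.2 v.2 + 2
  | .b, .a => cycleDist n u.2 v.2 + 1
  | .b, .b => if u.2.val = v.2.val then 0 else cycleDist n u.2 v.2 + 2
  | .b, .c => cycleDist n u.2 v.2 + 1
  | .b, .d => cycleDist n u.2 v.2 + 1
  | .c, .a => cycleDist n u.2 v.2 + 2
  | .c, .b => cycleDist n u.2 v.2 + 1
  | .c, .c => sameRailDist n u.2 v.2
  | .c, .d => crossRailDist n u.2 v.2
  | .d, .a => cycleDist n u.2 v.2 + 2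
  | .d, .b => cycleDist n u.2 v.2 + 1
  | .d, .c => crossRailDist n u.2 v.2
  | .d, .d => sameRailDist n u.2 v.2

theorem cycleDist_self (n i : ℕ) : cycleDist n i i = 0 := by simp [cycleDist]

theorem sameRailDist_self (n i : ℕ) : sameRailDist n i i = 0 := by simp [sameRailDist]

theorem flowerSnarkDist_self (n : ℕ) (u : FlowerKind × Fin n) : flowerSnarkDist n u u = 0 := by
  obtain ⟨k, i⟩ := u
  cases k <;> simp [flowerSnarkDist, cycleDist_self, sameRailDist_self]

theorem cycleDist_lipschitz {n i j j' : ℕ} (hi : i < n) (hj' : j' < n)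
    (h : j + 1 = j' ∨ (j + 1 = n ∧ j' = 0)) :
    cycleDist n i j' ≤ cycleDist n i j + 1 ∧ cycleDist n i j ≤ cycleDist n i j' + 1 := by
  unfold cycleDist; omega

theorem sameRailDist_lipschitz {n i j j' : ℕ} (hi : i < n) (hj' : j' < n) (h : j + 1 = j') :
    sameRailDist n i j' ≤ sameRailDist n i j + 1 ∧
      sameRailDist n i j ≤ sameRailDist n i j' + 1 := by
  unfold sameRailDist; omega

theorem crossRailDist_lipschitz {n i j j' : ℕ} (hi : i < n) (hj' : j' < n) (h : j + 1 = j') :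
    crossRailDist n i j' ≤ crossRailDist n i j + 1 ∧
      crossRailDist n i j ≤ crossRailDist n i j' + 1 := by
  unfold crossRailDist; omega

/-- The seam edges `c_n d_1` and `d_n c_1` change rail, so crossing them exchanges the two rail
distances. -/
theorem sameRailDist_crossRailDist_lipschitz {n i j j' : ℕ} (hi : i < n)
    (h : j + 1 = n ∧ j' = 0) :
    (crossRailDist n i j' ≤ sameRailDist n i j + 1 ∧
      sameRailDist n i j ≤ crossRailDist n i j' + 1) ∧
    (sameRailDist n i j' ≤ crossRailDist n i j + 1 ∧
      crossRailDist n i j ≤ sameRailDist n i j' + 1) := by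
  unfold crossRailDist sameRailDist; omega

/-- A shortest way round the index cycle ends on one of the two rails, and a star switches rails at
cost 2. -/
theorem railDist_bounds {n i j : ℕ} (hi : i < n) (hj : j < n) :
    (cycleDist n i j ≤ sameRailDist n i j ∧ sameRailDist n i j ≤ cycleDist n i j + 2) ∧
    (cycleDist n i j ≤ crossRailDist n i j ∧ crossRailDist n i j ≤ cycleDist n i j + 2) := by
  unfold crossRailDist sameRailDist cycleDist; omega

theorem flowerSnarkDist_le_of_rel {n : ℕ} (s : FlowerKind × Fin n)
    {u v : FlowerKind × Fin n} (h : flowerSnarkRel n u v) :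
    flowerSnarkDist n s v ≤ flowerSnarkDist n s u + 1 ∧
      flowerSnarkDist n s u ≤ flowerSnarkDist n s v + 1 := by
  obtain ⟨k, i, hi⟩ := s
  obtain ⟨l, j, hj⟩ := u
  obtain ⟨l', j', hj'⟩ := v
  have hbd := railDist_bounds hi hj
  have hself := cycleDist_self n i
  cases l <;> cases l' <;> simp only [flowerSnarkRel, Fin.mk.injEq] at h
  · have := cycleDist_lipschitz hi hj' h
    cases k <;> simp only [flowerSnarkDist] <;> omega
  · subst h
    cases k <;> simp only [flowerSnarkDist] <;> (try split_ifs with hs) <;> (try subst hs) <;> omega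
  · subst h
    cases k <;> simp only [flowerSnarkDist] <;> (try split_ifs with hs) <;> (try subst hs) <;> omega
  · subst h
    cases k <;> simp only [flowerSnarkDist] <;> (try split_ifs with hs) <;> (try subst hs) <;> omega
  · have h1 := cycleDist_lipschitz hi hj' (.inl h)
    have h2 := sameRailDist_lipschitz hi hj' h
    have h3 := crossRailDist_lipschitz hi hj' h
    cases k <;> simp only [flowerSnarkDist] <;> omega
  · have h1 := cycleDist_lipschitz hi hj' (.inr h)
    have h2 := sameRailDist_crossRailDist_lipschitz hi h
    cases k <;> simp only [flowerSnarkDist] <;> omega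
  · have h1 := cycleDist_lipschitz hi hj' (.inr h)
    have h2 := sameRailDist_crossRailDist_lipschitz hi h
    cases k <;> simp only [flowerSnarkDist] <;> omega
  · have h1 := cycleDist_lipschitz hi hj' (.inl h)
    have h2 := sameRailDist_lipschitz hi hj' h
    have h3 := crossRailDist_lipschitz hi hj' h
    cases k <;> simp only [flowerSnarkDist] <;> omega

theorem flowerSnark_adj_of_rel {n : ℕ} (hn : 5 ≤ n) {u v : FlowerKind × Fin n}
    (h : flowerSnarkRel n u v) : (flowerSnark n).Adj u v ∧ (flowerSnark n).Adj v u := by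
  have hne : u ≠ v := by
    rintro rfl
    obtain ⟨k, i⟩ := u
    cases k <;> simp only [flowerSnarkRel] at h <;> omega
  exact ⟨⟨hne, Or.inl h⟩, ⟨hne.symm, Or.inr h⟩⟩

theorem cycleDist_descent {n i j : ℕ} (hi : i < n) (hj : j < n) (hij : j ≠ i) :
    ∃ j' < n, ((j' + 1 = j ∨ (j' + 1 = n ∧ j = 0)) ∨ (j + 1 = j' ∨ (j + 1 = n ∧ j' = 0))) ∧
      cycleDist n i j' + 1 = cycleDist n i j := by
  unfold cycleDist
  rcases Nat.lt_or_gt_of_ne hij with h | h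
  · by_cases hnear : 2 * (i - j) ≤ n
    · exact ⟨j + 1, by omega, by omega, by omega⟩
    · by_cases hj0 : j = 0
      · exact ⟨n - 1, by omega, by omega, by omega⟩
      · exact ⟨j - 1, by omega, by omega, by omega⟩
  · by_cases hnear : 2 * (j - i) ≤ n
    · exact ⟨j - 1, by omega, by omega, by omega⟩
    · by_cases hjn : j + 1 = n
      · exact ⟨0, by omega, by omega, by omega⟩
      · exact ⟨j + 1, by omega, by omega, by omega⟩

/-- A shortest path staying on one rail never crosses the seam; one going the other way round
arrives on the opposite rail and can finish through the star at `j`. -/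
theorem sameRailDist_descent {n i j : ℕ} (hi : i < n) (hj : j < n) (hij : j ≠ i) :
    cycleDist n i j + 2 = sameRailDist n i j ∨
      ∃ j' < n, (j' + 1 = j ∨ j + 1 = j') ∧ sameRailDist n i j' + 1 = sameRailDist n i j := by
  by_contra! h
  -- For `j = 0` the truncated `j - 1` is harmless: neither adjacency alternative then holds.
  have h1 := h.2 (j - 1)
  have h2 := h.2 (j + 1)
  have h3 := h.1
  clear h
  unfold sameRailDist cycleDist at *
  omega

theorem crossRailDist_descent {n i j : ℕ} (hi : i < n) (hj : j < n) :
    cycleDist n i j + 2 = crossRailDist n i j ∨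
    (∃ j' < n, (j' + 1 = j ∨ j + 1 = j') ∧ crossRailDist n i j' + 1 = crossRailDist n i j) ∨
    ∃ j' < n, ((j' + 1 = n ∧ j = 0) ∨ (j + 1 = n ∧ j' = 0)) ∧
      sameRailDist n i j' + 1 = crossRailDist n i j := by
  unfold crossRailDist sameRailDist cycleDist
  by_cases hstar : i - j + (j - i) + 2 ≤ n - (i - j + (j - i))
  · exact .inl (by omega)
  · rcases Nat.lt_or_ge j i with h | h
    · by_cases hj0 : j = 0
      · exact .inr (.inr ⟨n - 1, by omega, by omega, by omega⟩)
      · exact .inr (.inl ⟨j - 1, by omega, by omega, by omega⟩)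
    · by_cases hjn : j + 1 = n
      · exact .inr (.inr ⟨0, by omega, by omega, by omega⟩)
      · exact .inr (.inl ⟨j + 1, by omega, by omega, by omega⟩)

/-- The direct way stays on the rail and the way round the seam changes it, so the shorter one
reaches one of the two rails at no extra cost. This picks the predecessor of a `b`-vertex on a path
from a rail vertex. -/
theorem cycleDist_eq_railDist {n i j : ℕ} (hodd : Odd n) (hi : i < n) (hj : j < n) :
    sameRailDist n i j = cycleDist n i j ∨ crossRailDist n i j = cycleDist n i j := by
  obtain ⟨m, hm⟩ := hodd
  unfold crossRailDist sameRailDist cycleDist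
  omega

theorem exists_rel_flowerSnarkDist_descent {n : ℕ} (hodd : Odd n)
    (s v : FlowerKind × Fin n) (hv : v ≠ s) :
    ∃ u, (flowerSnarkRel n u v ∨ flowerSnarkRel n v u) ∧
      flowerSnarkDist n s u + 1 = flowerSnarkDist n s v := by
  obtain ⟨k, i, hi⟩ := s
  obtain ⟨l, j, hj⟩ := v
  have hself := cycleDist_self n i
  cases l
  · by_cases hij : j = i
    · subst hij
      cases k
      · exact absurd rfl hv
      all_goals exact ⟨(.b, ⟨j, hj⟩), .inl rfl, by simp [flowerSnarkDist, hself]⟩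
    · obtain ⟨j', hj', h, hd⟩ := cycleDist_descent hi hj hij
      refine ⟨(.a, ⟨j', hj'⟩), h, ?_⟩
      cases k <;> simp only [flowerSnarkDist] <;> omega
  · cases k
    · exact ⟨(.a, ⟨j, hj⟩), .inr rfl, rfl⟩
    · have hij : i ≠ j := by rintro rfl; exact hv rfl
      exact ⟨(.a, ⟨j, hj⟩), .inr rfl, by simp [flowerSnarkDist, hij]⟩
    · rcases cycleDist_eq_railDist hodd hi hj with h | h
      · exact ⟨(.c, ⟨j, hj⟩), .inr rfl, by simp [flowerSnarkDist, h]⟩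
      · exact ⟨(.d, ⟨j, hj⟩), .inr rfl, by simp [flowerSnarkDist, h]⟩
    · rcases cycleDist_eq_railDist hodd hi hj with h | h
      · exact ⟨(.d, ⟨j, hj⟩), .inr rfl, by simp [flowerSnarkDist, h]⟩
      · exact ⟨(.c, ⟨j, hj⟩), .inr rfl, by simp [flowerSnarkDist, h]⟩
  · cases k
    · exact ⟨(.b, ⟨j, hj⟩), .inl rfl, rfl⟩
    · by_cases hij : j = i
      · subst hij
        exact ⟨(.b, ⟨j, hj⟩), .inl rfl, by simp [flowerSnarkDist, hself]⟩
      · obtain ⟨j', hj', (h | h) | (h | h), hd⟩ := cycleDist_descent hi hj hij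
        · exact ⟨(.c, ⟨j', hj'⟩), .inl h, by simp only [flowerSnarkDist]; omega⟩
        · exact ⟨(.d, ⟨j', hj'⟩), .inl h, by simp only [flowerSnarkDist]; omega⟩
        · exact ⟨(.c, ⟨j', hj'⟩), .inr h, by simp only [flowerSnarkDist]; omega⟩
        · exact ⟨(.d, ⟨j', hj'⟩), .inr h, by simp only [flowerSnarkDist]; omega⟩
    · have hij : j ≠ i := by rintro rfl; exact hv rfl
      rcases sameRailDist_descent hi hj hij with h | ⟨j', hj', h, hd⟩
      · exact ⟨(.b, ⟨j, hj⟩), .inl rfl, h⟩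
      · exact ⟨(.c, ⟨j', hj'⟩), h, hd⟩
    · rcases crossRailDist_descent hi hj with h | ⟨j', hj', h, hd⟩ | ⟨j', hj', h, hd⟩
      · exact ⟨(.b, ⟨j, hj⟩), .inl rfl, h⟩
      · exact ⟨(.c, ⟨j', hj'⟩), h, hd⟩
      · exact ⟨(.d, ⟨j', hj'⟩), h, hd⟩
  · cases k
    · exact ⟨(.b, ⟨j, hj⟩), .inl rfl, rfl⟩
    · by_cases hij : j = i
      · subst hij
        exact ⟨(.b, ⟨j, hj⟩), .inl rfl, by simp [flowerSnarkDist, hself]⟩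
      · obtain ⟨j', hj', (h | h) | (h | h), hd⟩ := cycleDist_descent hi hj hij
        · exact ⟨(.d, ⟨j', hj'⟩), .inl h, by simp only [flowerSnarkDist]; omega⟩
        · exact ⟨(.c, ⟨j', hj'⟩), .inl h, by simp only [flowerSnarkDist]; omega⟩
        · exact ⟨(.d, ⟨j', hj'⟩), .inr h, by simp only [flowerSnarkDist]; omega⟩
        · exact ⟨(.c, ⟨j', hj'⟩), .inr h, by simp only [flowerSnarkDist]; omega⟩
    · rcases crossRailDist_descent hi hj with h | ⟨j', hj', h, hd⟩ | ⟨j', hj', h, hd⟩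
      · exact ⟨(.b, ⟨j, hj⟩), .inl rfl, h⟩
      · exact ⟨(.d, ⟨j', hj'⟩), h, hd⟩
      · exact ⟨(.c, ⟨j', hj'⟩), h, hd⟩
    · have hij : j ≠ i := by rintro rfl; exact hv rfl
      rcases sameRailDist_descent hi hj hij with h | ⟨j', hj', h, hd⟩
      · exact ⟨(.b, ⟨j, hj⟩), .inl rfl, h⟩
      · exact ⟨(.d, ⟨j', hj'⟩), h, hd⟩

theorem flowerSnark_edist {n : ℕ} (hodd : Odd n) (hn : 5 ≤ n) (s v : FlowerKind × Fin n) :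
    (flowerSnark n).edist s v = flowerSnarkDist n s v := by
  refine SimpleGraph.edist_eq_of_descent _ _ (flowerSnarkDist_self n s) ?_ ?_ v
  · rintro u v ⟨-, h | h⟩
    · exact (flowerSnarkDist_le_of_rel s h).1
    · exact (flowerSnarkDist_le_of_rel s h).2
  · intro v hv
    obtain ⟨u, h | h, hu⟩ := exists_rel_flowerSnarkDist_descent hodd s v hv
    · exact ⟨u, (flowerSnark_adj_of_rel hn h).1, hu⟩
    · exact ⟨u, (flowerSnark_adj_of_rel hn h).2, hu⟩

/-! ### Separating sets and the rotation symmetry -/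

/-- Every ordered pair of distinct vertices of `J_n` is told apart by an element of `S` that is
strictly closer to the first vertex. -/
def FlowerSnarkSeparates (n : ℕ) (S : Finset (FlowerKind × Fin n)) : Prop :=
  ∀ x y, x ≠ y → ∃ s ∈ S, flowerSnarkDist n s x < flowerSnarkDist n s y

/-- The number of elements of `S` whose kind satisfies `p`. -/
def kindCount {n : ℕ} (S : Finset (FlowerKind × Fin n)) (p : FlowerKind → Prop)
    [DecidablePred p] : ℕ :=
  (S.filter fun s => p s.1).card

/-- Exchange the kinds `c` and `d`. -/
def FlowerKind.swap : FlowerKind → FlowerKind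
  | .a => .a
  | .b => .b
  | .c => .d
  | .d => .c

/-- The rotation of the flower snark, which increases each index by one. -/
def flowerSnarkRotate (n : ℕ) (u : FlowerKind × Fin n) : FlowerKind × Fin n :=
  if h : u.2.val + 1 < n then (u.1, ⟨u.2.val + 1, h⟩)
  else (u.1.swap, ⟨0, by have := u.2.isLt; omega⟩)

theorem flowerSnarkRotate_injective (n : ℕ) : Function.Injective (flowerSnarkRotate n) := by
  rintro ⟨k, i, hi⟩ ⟨l, j, hj⟩ h
  unfold flowerSnarkRotate at h
  split_ifs at h with h1 h2 h2 <;> simp only [Prod.mk.injEq, Fin.mk.injEq] at h h1 h2 ⊢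
  · exact ⟨h.1, by omega⟩
  · omega
  · omega
  · refine ⟨?_, by omega⟩
    have := h.1
    cases k <;> cases l <;> simp_all [FlowerKind.swap]

/-- If just one of the two vertices passes the seam, the index gap `t` becomes `n - t` and one rail
is swapped, so the two rail formulas turn into each other. -/
theorem flowerSnarkDist_rotate {n : ℕ} (u v : FlowerKind × Fin n) :
    flowerSnarkDist n (flowerSnarkRotate n u) (flowerSnarkRotate n v) = flowerSnarkDist n u v := by
  obtain ⟨k, i, hi⟩ := u
  obtain ⟨l, j, hj⟩ := v
  have key : ∀ i j, cycleDist n (i + 1) (j + 1) = cycleDist n i j ∧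
      sameRailDist n (i + 1) (j + 1) = sameRailDist n i j ∧
      crossRailDist n (i + 1) (j + 1) = crossRailDist n i j := by
    intro i j
    unfold cycleDist sameRailDist crossRailDist
    omega
  have hleft : i + 1 = n → j + 1 < n → cycleDist n 0 (j + 1) = cycleDist n i j ∧
      sameRailDist n 0 (j + 1) = crossRailDist n i j ∧
      crossRailDist n 0 (j + 1) = sameRailDist n i j := by
    unfold cycleDist sameRailDist crossRailDist
    omega
  have hright : i + 1 < n → j + 1 = n → cycleDist n (i + 1) 0 = cycleDist n i j ∧
      sameRailDist n (i + 1) 0 = crossRailDist n i j ∧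
      crossRailDist n (i + 1) 0 = sameRailDist n i j := by
    unfold cycleDist sameRailDist crossRailDist
    omega
  have hboth : i + 1 = n → j + 1 = n → i = j := by omega
  have hiff : i + 1 = j + 1 ↔ i = j := by omega
  unfold flowerSnarkRotate
  split_ifs with h1 h2 h2 <;> simp only at h1 h2
  · cases k <;> cases l <;> simp [flowerSnarkDist, key]
  · have h := hright h1 (by omega)
    have hne : i ≠ j := by omega
    cases k <;> cases l <;> simp [flowerSnarkDist, FlowerKind.swap, h, hne]
  · have h := hleft (by omega) h2
    have hne : i ≠ j := by omega
    cases k <;> cases l <;> simp [flowerSnarkDist, FlowerKind.swap, h, hne]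
  · obtain rfl := hboth (by omega) (by omega)
    cases k <;> cases l <;>
      simp [flowerSnarkDist, FlowerKind.swap, cycleDist, sameRailDist, crossRailDist]

theorem FlowerSnarkSeparates.exists_unrotate {n : ℕ} {S : Finset (FlowerKind × Fin n)}
    (hS : FlowerSnarkSeparates n S) :
    ∃ S' : Finset (FlowerKind × Fin n), FlowerSnarkSeparates n S' ∧
      (∀ u, u ∈ S' ↔ flowerSnarkRotate n u ∈ S) ∧
      ∀ (p : FlowerKind → Prop) [DecidablePred p], (∀ k, p k.swap ↔ p k) →
        kindCount S' p = kindCount S p := by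
  have hinj := flowerSnarkRotate_injective n
  have hsurj := Finite.surjective_of_injective hinj
  refine ⟨Finset.univ.filter fun u => flowerSnarkRotate n u ∈ S, ?_, by simp, ?_⟩
  · intro x y hxy
    obtain ⟨s, hs, hlt⟩ := hS _ _ (hinj.ne hxy)
    obtain ⟨s, rfl⟩ := hsurj s
    exact ⟨s, by simpa using hs, by simpa only [flowerSnarkDist_rotate] using hlt⟩
  · intro p _ hp
    have hkind : ∀ u, p (flowerSnarkRotate n u).1 ↔ p u.1 := by
      intro u
      unfold flowerSnarkRotate
      split_ifs
      · rfl
      · exact hp _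
    unfold kindCount
    rw [← Finset.card_image_of_injective _ hinj]
    congr 1
    ext v
    obtain ⟨u, rfl⟩ := hsurj v
    simp [hinj.eq_iff, hkind]

theorem FlowerSnarkSeparates.exists_index_zero {n : ℕ} {S : Finset (FlowerKind × Fin n)}
    (hS : FlowerSnarkSeparates n S) {k : FlowerKind} {i : ℕ} (hi : i < n)
    (hmem : (k, ⟨i, hi⟩) ∈ S) :
    ∃ S' : Finset (FlowerKind × Fin n), FlowerSnarkSeparates n S' ∧
      (k, ⟨0, by omega⟩) ∈ S' ∧
      ∀ (p : FlowerKind → Prop) [DecidablePred p], (∀ k, p k.swap ↔ p k) →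
        kindCount S' p = kindCount S p := by
  induction i generalizing S with
  | zero => exact ⟨S, hS, hmem, fun _ _ _ => rfl⟩
  | succ i ih =>
    obtain ⟨S₁, hS₁, hmem₁, hcount₁⟩ := hS.exists_unrotate
    obtain ⟨S₂, hS₂, hmem₂, hcount₂⟩ := ih hS₁ (by omega) (by
      rw [hmem₁]
      simpa [flowerSnarkRotate, hi] using hmem)
    exact ⟨S₂, hS₂, hmem₂, fun p _ hp => (hcount₂ p hp).trans (hcount₁ p hp)⟩

theorem FlowerSnarkSeparates.exists_c_zero {n : ℕ} {S : Finset (FlowerKind × Fin n)}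
    (hS : FlowerSnarkSeparates n S) {s : FlowerKind × Fin n} (hs : s ∈ S)
    (hk : s.1 = .c ∨ s.1 = .d) :
    ∃ S' : Finset (FlowerKind × Fin n), FlowerSnarkSeparates n S' ∧
      (.c, ⟨0, by have := s.2.isLt; omega⟩) ∈ S' ∧
      ∀ (p : FlowerKind → Prop) [DecidablePred p], (∀ k, p k.swap ↔ p k) →
        kindCount S' p = kindCount S p := by
  obtain ⟨k, i, hi⟩ := s
  rcases hk with rfl | rfl
  · exact hS.exists_index_zero hi hs
  · obtain ⟨S₁, hS₁, hmem₁, hcount₁⟩ := hS.exists_index_zero hi hs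
    obtain ⟨S₂, hS₂, hmem₂, hcount₂⟩ := hS₁.exists_unrotate
    -- `d_0` is the rotation of `c_{n-1}`, so one step back across the seam changes the rail.
    obtain ⟨S₃, hS₃, hmem₃, hcount₃⟩ := hS₂.exists_index_zero (k := .c) (i := n - 1) (by omega) (by
      rw [hmem₂]
      simpa [flowerSnarkRotate, FlowerKind.swap, Nat.sub_add_cancel (by omega : 1 ≤ n)] using hmem₁)
    exact ⟨S₃, hS₃, hmem₃, fun p _ hp =>
      (hcount₃ p hp).trans ((hcount₂ p hp).trans (hcount₁ p hp))⟩

/-! ### Counting by kind -/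

theorem kindCount_a_add_b_add_rail {n : ℕ} (S : Finset (FlowerKind × Fin n)) :
    kindCount S (· = .a) + kindCount S (· = .b) + kindCount S (fun k => k = .c ∨ k = .d) =
      S.card := by
  have h1 := Finset.card_filter_add_card_filter_not (s := S) 
    (fun s => s.1 = FlowerKind.a ∨ s.1 = FlowerKind.b)
  have h2 : (S.filter fun s => s.1 = FlowerKind.a ∨ s.1 = FlowerKind.b).card =
      kindCount S (· = .a) + kindCount S (· = .b) := by
    rw [Finset.filter_or, Finset.card_union_of_disjoint]
    · rfl
    · rw [Finset.disjoint_filter]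
      intro s _ hs
      simp [hs]
  have h3 : kindCount S (fun k => k = .c ∨ k = .d) =
      (S.filter fun s => ¬ (s.1 = FlowerKind.a ∨ s.1 = FlowerKind.b)).card := by
    unfold kindCount
    congr 1
    ext ⟨k, i⟩
    cases k <;> simp
  omega

theorem list_length_le_kindCount {n : ℕ} {S : Finset (FlowerKind × Fin n)}
    {p : FlowerKind → Prop} [DecidablePred p] (l : List (FlowerKind × Fin n)) (hl : l.Nodup)
    (h : ∀ s ∈ l, s ∈ S ∧ p s.1) : l.length ≤ kindCount S p := by
  rw [← List.toFinset_card_of_nodup hl]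
  exact Finset.card_le_card fun s hs => by simpa using h s (by simpa using hs)

/-! ### The lower bound -/

namespace FlowerSnarkSeparates

variable {n : ℕ} {S : Finset (FlowerKind × Fin n)} (hS : FlowerSnarkSeparates n S)
  (hodd : Odd n) (hn : 5 ≤ n)

include hS hodd hn

/-- No `b`-vertex or rail vertex is closer to `a_0` than to `c_0`: the former are equidistant, the
latter lose by `railDist_bounds`. -/
theorem exists_a_mem : ∃ i, ∃ hi : i < n, (.a, ⟨i, hi⟩) ∈ S := by
  obtain ⟨⟨k, j, hj⟩, hs, hlt⟩ := hS (.a, ⟨0, by omega⟩) (.c, ⟨0, by omega⟩) (by simp)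
  obtain ⟨m, hm⟩ := hodd
  cases k <;>
    simp only [flowerSnarkDist, cycleDist, sameRailDist, crossRailDist] at hlt
  · exact ⟨j, hj, hs⟩
  all_goals omega

/-- Among `2 n` cyclically arranged rail vertices, every `n` consecutive ones meet `S`. -/
theorem exists_rail_mem_window {p : ℕ} (hp : p < n) :
    (∃ k j, ∃ hj : j < n, (k, ⟨j, hj⟩) ∈ S ∧
      (k = .c ∧ j ≤ p + n / 2 ∧ p ≤ j + n / 2 ∨
        k = .d ∧ (j + n / 2 < p ∨ p + n / 2 < j))) := by
  obtain ⟨⟨k, j, hj⟩, hs, hlt⟩ := hS (.c, ⟨p, hp⟩) (.d, ⟨p, hp⟩) (by simp)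
  obtain ⟨m, hm⟩ := hodd
  refine ⟨k, j, hj, hs, ?_⟩
  cases k <;>
    simp only [flowerSnarkDist, cycleDist, sameRailDist, crossRailDist] at hlt <;> simp <;> omega

theorem exists_rail_mem_window' {p : ℕ} (hp : p < n) :
    (∃ k j, ∃ hj : j < n, (k, ⟨j, hj⟩) ∈ S ∧
      (k = .d ∧ j ≤ p + n / 2 ∧ p ≤ j + n / 2 ∨
        k = .c ∧ (j + n / 2 < p ∨ p + n / 2 < j))) := by
  obtain ⟨⟨k, j, hj⟩, hs, hlt⟩ := hS (.d, ⟨p, hp⟩) (.c, ⟨p, hp⟩) (by simp)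
  obtain ⟨m, hm⟩ := hodd
  refine ⟨k, j, hj, hs, ?_⟩
  cases k <;>
    simp only [flowerSnarkDist, cycleDist, sameRailDist, crossRailDist] at hlt <;> simp <;> omega

/-- Here `q` is one step from `p` towards `0`. Besides `b_p`, only a rail vertex whose index is no
farther from `p` than from `q` serves the pair `(b_p, a_q)`, which excludes index `0`. -/
theorem b_mem_or_rail_mem {p q : ℕ} (hp : 0 < p) (hpn : p < n)
    (hq : q + 1 = p ∧ p ≤ n / 2 ∨ n / 2 < p ∧ (p + 1 = q ∨ p + 1 = n ∧ q = 0)) (hqn : q < n) :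
    (.b, ⟨p, hpn⟩) ∈ S ∨ ∃ k j, ∃ hj : j < n, (k, ⟨j, hj⟩) ∈ S ∧ (k = .c ∨ k = .d) ∧ 0 < j := by
  obtain ⟨⟨k, j, hj⟩, hs, hlt⟩ := hS (.b, ⟨p, hpn⟩) (.a, ⟨q, hqn⟩) (by simp)
  obtain ⟨m, hm⟩ := hodd
  cases k
  · simp only [flowerSnarkDist] at hlt
    simp only [cycleDist] at hlt
    omega
  · left
    have hjp : j = p := by
      simp only [flowerSnarkDist] at hlt
      split_ifs at hlt with h
      · exact h
      · simp only [cycleDist] at hlt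
        omega
    subst hjp
    exact hs
  · right
    refine ⟨_, _, _, hs, .inl rfl, ?_⟩
    simp only [flowerSnarkDist, cycleDist] at hlt
    omega
  · right
    refine ⟨_, _, _, hs, .inr rfl, ?_⟩
    simp only [flowerSnarkDist, cycleDist] at hlt
    omega

/-- Two points meet every window of `n` consecutive vertices of a `2n`-cycle only if they are
antipodal, here `c_0` and `d_0`. Both have index `0`, so `b_mem_or_rail_mem` then forces four
`b`-vertices. -/
theorem three_le_rail_or_four_le_b_of_c_zero (h0 : (.c, ⟨0, by omega⟩) ∈ S) :
    3 ≤ kindCount S (fun k => k = .c ∨ k = .d) ∨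
      4 ≤ kindCount S (· = .b) ∧ 2 ≤ kindCount S (fun k => k = .c ∨ k = .d) := by
  obtain ⟨m, hm⟩ := id hodd
  have hdiv : n / 2 = m := by omega
  -- This window consists of the `n` rail vertices following `c_0`, ending in `d_0`.
  obtain ⟨k, r, hr, hrS, hkr⟩ := hS.exists_rail_mem_window hodd hn (p := m + 1) (by omega)
  rw [hdiv] at hkr
  rcases hkr with ⟨rfl, hr1, hr2⟩ | ⟨rfl, hr1⟩
  · left
    -- The window following `c_r` contains neither `c_0` nor `c_r`; its centre lies on the `c`- or
    -- the `d`-rail according to this case.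
    by_cases hrm : r + m + 1 < n
    · obtain ⟨k, t, ht, htS, hkt⟩ := hS.exists_rail_mem_window hodd hn hrm
      rw [hdiv] at hkt
      refine list_length_le_kindCount [(.c, ⟨0, by omega⟩), (.c, ⟨r, hr⟩), (k, ⟨t, ht⟩)] ?_ ?_
      · rcases hkt with ⟨rfl, hkt⟩ | ⟨rfl, hkt⟩ <;> simp <;> omega
      · rcases hkt with ⟨rfl, hkt⟩ | ⟨rfl, hkt⟩ <;> simp [h0, hrS, htS]
    · obtain ⟨k, t, ht, htS, hkt⟩ := hS.exists_rail_mem_window' hodd hn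
        (p := r + m + 1 - n) (by omega)
      rw [hdiv] at hkt
      refine list_length_le_kindCount [(.c, ⟨0, by omega⟩), (.c, ⟨r, hr⟩), (k, ⟨t, ht⟩)] ?_ ?_
      · rcases hkt with ⟨rfl, hkt⟩ | ⟨rfl, hkt⟩ <;> simp <;> omega
      · rcases hkt with ⟨rfl, hkt⟩ | ⟨rfl, hkt⟩ <;> simp [h0, hrS, htS]
  · obtain rfl : r = 0 := by omega
    by_cases hex : ∃ k j, ∃ hj : j < n, (k, ⟨j, hj⟩) ∈ S ∧ (k = .c ∨ k = .d) ∧ 0 < j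
    · left
      obtain ⟨k, j, hj, hjS, hk, hj0⟩ := hex
      refine list_length_le_kindCount [(.c, ⟨0, by omega⟩), (.d, ⟨0, by omega⟩), (k, ⟨j, hj⟩)] ?_ ?_
      · simp; omega
      · simp [h0, hrS, hjS, hk]
    · right
      have hb1 := (hS.b_mem_or_rail_mem hodd hn (p := 1) (q := 0) (by omega) (by omega)
        (by omega) (by omega)).resolve_right hex
      have hb2 := (hS.b_mem_or_rail_mem hodd hn (p := 2) (q := 1) (by omega) (by omega)
        (by omega) (by omega)).resolve_right hex
      have hb3 := (hS.b_mem_or_rail_mem hodd hn (p := n - 2) (q := n - 1) (by omega) (by omega)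
        (by omega) (by omega)).resolve_right hex
      have hb4 := (hS.b_mem_or_rail_mem hodd hn (p := n - 1) (q := 0) (by omega) (by omega)
        (by omega) (by omega)).resolve_right hex
      refine ⟨list_length_le_kindCount [(.b, ⟨1, by omega⟩), (.b, ⟨2, by omega⟩),
          (.b, ⟨n - 2, by omega⟩), (.b, ⟨n - 1, by omega⟩)] ?_ (by simp [hb1, hb2, hb3, hb4]),
        list_length_le_kindCount [(.c, ⟨0, by omega⟩), (.d, ⟨0, by omega⟩)] ?_ ?_⟩
      · simp; omega
      · simp
      · simp [h0, hrS]

/-- Without `b`-vertices, putting a rail vertex before the `b`-vertex one index back needs an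
element of `S` among the `m + 1` rail vertices starting there. Three consecutive such arcs starting
at `c_1` fit without returning to `c_0`, as `1 + 3(m + 1) ≤ 4m + 2`. -/
theorem four_le_rail_of_no_b_of_c_zero (h0 : (.c, ⟨0, by omega⟩) ∈ S)
    (hb : kindCount S (· = .b) = 0) : 4 ≤ kindCount S (fun k => k = .c ∨ k = .d) := by
  obtain ⟨m, hm⟩ := id hodd
  have hnb : ∀ j, (.b, j) ∉ S := by
    intro j hj
    have := list_length_le_kindCount (p := (· = .b)) [(.b, j)] (by simp) (by simpa using hj)
    simp [hb] at this
  obtain ⟨⟨k₁, j₁, hj₁⟩, hs₁, hlt₁⟩ := hS (.c, ⟨1, by omega⟩) (.b, ⟨0, by omega⟩) (by simp)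
  have h₁ : k₁ = .c ∧ 0 < j₁ ∧ j₁ ≤ m + 1 := by
    cases k₁ <;> simp only [flowerSnarkDist, cycleDist, sameRailDist, crossRailDist] at hlt₁
    · omega
    · exact absurd hs₁ (hnb _)
    · exact ⟨rfl, by omega⟩
    · omega
  obtain ⟨⟨k₂, j₂, hj₂⟩, hs₂, hlt₂⟩ :=
    hS (.c, ⟨m + 2, by omega⟩) (.b, ⟨m + 1, by omega⟩) (by simp)
  have h₂ : k₂ = .c ∧ m + 1 < j₂ ∨ k₂ = .d ∧ j₂ ≤ 1 := by
    cases k₂ <;> simp only [flowerSnarkDist, cycleDist, sameRailDist, crossRailDist] at hlt₂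
    · omega
    · exact absurd hs₂ (hnb _)
    · exact .inl ⟨rfl, by omega⟩
    · exact .inr ⟨rfl, by omega⟩
  obtain ⟨⟨k₃, j₃, hj₃⟩, hs₃, hlt₃⟩ := hS (.d, ⟨2, by omega⟩) (.b, ⟨1, by omega⟩) (by simp)
  have h₃ : k₃ = .d ∧ 1 < j₃ := by
    cases k₃ <;> simp only [flowerSnarkDist, cycleDist, sameRailDist, crossRailDist] at hlt₃
    · omega
    · exact absurd hs₃ (hnb _)
    · omega
    · exact ⟨rfl, by omega⟩
  obtain ⟨rfl, h₁⟩ := h₁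
  obtain ⟨rfl, h₃⟩ := h₃
  refine list_length_le_kindCount
    [(.c, ⟨0, by omega⟩), (.c, ⟨j₁, hj₁⟩), (k₂, ⟨j₂, hj₂⟩), (.d, ⟨j₃, hj₃⟩)] ?_ ?_
  · rcases h₂ with ⟨rfl, h₂⟩ | ⟨rfl, h₂⟩ <;> simp <;> omega
  · rcases h₂ with ⟨rfl, h₂⟩ | ⟨rfl, h₂⟩ <;> simp [h0, hs₁, hs₂, hs₃]

theorem exists_c_zero' :
    ∃ S' : Finset (FlowerKind × Fin n), FlowerSnarkSeparates n S' ∧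
      (.c, ⟨0, by omega⟩) ∈ S' ∧
      kindCount S' (· = .b) = kindCount S (· = .b) ∧
      kindCount S' (fun k => k = .c ∨ k = .d) = kindCount S (fun k => k = .c ∨ k = .d) := by
  obtain ⟨k, j, hj, hs, hk⟩ := hS.exists_rail_mem_window hodd hn (p := 0) (by omega)
  obtain ⟨S', hS', h0, hcount⟩ := hS.exists_c_zero hs
    (by rcases hk with ⟨rfl, -⟩ | ⟨rfl, -⟩ <;> simp)
  exact ⟨S', hS', h0, hcount _ (by rintro (_ | _ | _ | _) <;> simp [FlowerKind.swap]),
    hcount _ (by rintro (_ | _ | _ | _) <;> simp [FlowerKind.swap])⟩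

theorem three_le_rail_or_four_le_b :
    3 ≤ kindCount S (fun k => k = .c ∨ k = .d) ∨
      4 ≤ kindCount S (· = .b) ∧ 2 ≤ kindCount S (fun k => k = .c ∨ k = .d) := by
  obtain ⟨S', hS', h0, hb, hr⟩ := hS.exists_c_zero' hodd hn
  rw [← hb, ← hr]
  exact hS'.three_le_rail_or_four_le_b_of_c_zero hodd hn h0

theorem four_le_rail_of_no_b (hb : kindCount S (· = .b) = 0) :
    4 ≤ kindCount S (fun k => k = .c ∨ k = .d) := by
  obtain ⟨S', hS', h0, hb', hr⟩ := hS.exists_c_zero' hodd hn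
  rw [← hr]
  exact hS'.four_le_rail_of_no_b_of_c_zero hodd hn h0 (hb'.trans hb)

/-- If the vertices of kinds `a` and `b` in `S` avoid the indices next to `0`, then each half of
each rail meets `S`. -/
theorem four_le_rail_of_b_middle
    (ha : ∀ j, (.a, j) ∈ S → j.val = 0)
    (hb : ∀ j, (.b, j) ∈ S → 1 < j.val ∧ j.val + 1 < n) :
    4 ≤ kindCount S (fun k => k = .c ∨ k = .d) := by
  obtain ⟨m, hm⟩ := id hodd
  obtain ⟨⟨k₁, j₁, hj₁⟩, hs₁, hlt₁⟩ := hS (.b, ⟨1, by omega⟩) (.c, ⟨0, by omega⟩) (by simp)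
  have h₁ : k₁ = .d ∧ 0 < j₁ ∧ j₁ ≤ m := by
    cases k₁
    · have := ha _ hs₁
      simp only [flowerSnarkDist, cycleDist] at hlt₁ this
      omega
    · have := hb _ hs₁
      simp only at this
      simp only [flowerSnarkDist, cycleDist, if_neg (show j₁ ≠ 1 by omega)] at hlt₁
      omega
    · simp only [flowerSnarkDist, cycleDist, sameRailDist] at hlt₁
      omega
    · simp only [flowerSnarkDist, cycleDist, crossRailDist] at hlt₁
      exact ⟨rfl, by omega⟩
  obtain ⟨⟨k₂, j₂, hj₂⟩, hs₂, hlt₂⟩ := hS (.b, ⟨1, by omega⟩) (.d, ⟨0, by omega⟩) (by simp)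
  have h₂ : k₂ = .c ∧ 0 < j₂ ∧ j₂ ≤ m := by
    cases k₂
    · have := ha _ hs₂
      simp only [flowerSnarkDist, cycleDist] at hlt₂ this
      omega
    · have := hb _ hs₂
      simp only at this
      simp only [flowerSnarkDist, cycleDist, if_neg (show j₂ ≠ 1 by omega)] at hlt₂
      omega
    · simp only [flowerSnarkDist, cycleDist, crossRailDist] at hlt₂
      exact ⟨rfl, by omega⟩
    · simp only [flowerSnarkDist, cycleDist, sameRailDist] at hlt₂
      omega
  obtain ⟨⟨k₃, j₃, hj₃⟩, hs₃, hlt₃⟩ :=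
    hS (.b, ⟨n - 1, by omega⟩) (.c, ⟨0, by omega⟩) (by simp)
  have h₃ : k₃ = .c ∧ m < j₃ := by
    cases k₃
    · have := ha _ hs₃
      simp only [flowerSnarkDist, cycleDist] at hlt₃ this
      omega
    · have := hb _ hs₃
      simp only at this
      simp only [flowerSnarkDist, cycleDist, if_neg (show j₃ ≠ n - 1 by omega)] at hlt₃
      omega
    · simp only [flowerSnarkDist, cycleDist, sameRailDist] at hlt₃
      exact ⟨rfl, by omega⟩
    · simp only [flowerSnarkDist, cycleDist, crossRailDist] at hlt₃
      omega
  obtain ⟨⟨k₄, j₄, hj₄⟩, hs₄, hlt₄⟩ :=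
    hS (.b, ⟨n - 1, by omega⟩) (.d, ⟨0, by omega⟩) (by simp)
  have h₄ : k₄ = .d ∧ m < j₄ := by
    cases k₄
    · have := ha _ hs₄
      simp only [flowerSnarkDist, cycleDist] at hlt₄ this
      omega
    · have := hb _ hs₄
      simp only at this
      simp only [flowerSnarkDist, cycleDist, if_neg (show j₄ ≠ n - 1 by omega)] at hlt₄
      omega
    · simp only [flowerSnarkDist, cycleDist, crossRailDist] at hlt₄
      omega
    · simp only [flowerSnarkDist, cycleDist, sameRailDist] at hlt₄
      exact ⟨rfl, by omega⟩
  obtain ⟨rfl, h₁⟩ := h₁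
  obtain ⟨rfl, h₂⟩ := h₂
  obtain ⟨rfl, h₃⟩ := h₃
  obtain ⟨rfl, h₄⟩ := h₄
  exact list_length_le_kindCount
    [(.d, ⟨j₁, hj₁⟩), (.c, ⟨j₂, hj₂⟩), (.c, ⟨j₃, hj₃⟩), (.d, ⟨j₄, hj₄⟩)]
    (by simp; omega) (by simp [hs₁, hs₂, hs₃, hs₄])

/-- With only `a_0` of kind `a`, the pairs `(a_1, b_0)` and `(a_m, b_{m-1})` can be served only by
`b`-vertices, with index at most `m + 1` and at least `m` respectively. A single `b`-vertex serving
both is away from index `0` and its neighbours, since `m ≥ 2`. -/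
theorem six_le_card_of_a_zero (h0 : (.a, ⟨0, by omega⟩) ∈ S) : 6 ≤ S.card := by
  obtain ⟨m, hm⟩ := id hodd
  have hsum := kindCount_a_add_b_add_rail S
  have hrail := hS.three_le_rail_or_four_le_b hodd hn
  have hnob := hS.four_le_rail_of_no_b hodd hn
  have ha1 : 1 ≤ kindCount S (· = .a) :=
    list_length_le_kindCount [(.a, ⟨0, by omega⟩)] (by simp) (by simp [h0])
  by_contra! hcard
  have ha2 : ¬ 2 ≤ kindCount S (· = .a) := by omega
  have hb2 : ¬ 2 ≤ kindCount S (· = .b) := by omega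
  have haz : ∀ j, (.a, j) ∈ S → j.val = 0 := by
    intro j hj
    by_contra hne
    exact ha2 (list_length_le_kindCount [(.a, ⟨0, by omega⟩), (.a, j)]
      (by simp [Fin.ext_iff]; omega) (by simp [h0, hj]))
  have hbu : ∀ i j, (.b, i) ∈ S → (.b, j) ∈ S → i = j := by
    intro i j hi hj
    by_contra hne
    exact hb2 (list_length_le_kindCount [(.b, i), (.b, j)] (by simpa using hne) (by simp [hi, hj]))
  obtain ⟨⟨k₁, j₁, hj₁⟩, hs₁, hlt₁⟩ := hS (.a, ⟨1, by omega⟩) (.b, ⟨0, by omega⟩) (by simp)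
  have h₁ : k₁ = .b ∧ j₁ ≤ m + 1 := by
    cases k₁
    · have := haz _ hs₁
      simp only [flowerSnarkDist, cycleDist] at hlt₁ this
      omega
    · by_cases hj : j₁ = 0
      · exact ⟨rfl, by omega⟩
      · simp only [flowerSnarkDist, cycleDist, if_neg hj] at hlt₁
        exact ⟨rfl, by omega⟩
    all_goals
      simp only [flowerSnarkDist, cycleDist] at hlt₁
      omega
  obtain ⟨⟨k₂, j₂, hj₂⟩, hs₂, hlt₂⟩ :=
    hS (.a, ⟨m, by omega⟩) (.b, ⟨m - 1, by omega⟩) (by simp)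
  have h₂ : k₂ = .b ∧ m ≤ j₂ := by
    cases k₂
    · have := haz _ hs₂
      simp only [flowerSnarkDist, cycleDist] at hlt₂ this
      omega
    · by_cases hj : j₂ = m - 1
      · simp [flowerSnarkDist, hj] at hlt₂
      · simp only [flowerSnarkDist, cycleDist, if_neg hj] at hlt₂
        exact ⟨rfl, by omega⟩
    all_goals
      simp only [flowerSnarkDist, cycleDist] at hlt₂
      omega
  obtain ⟨rfl, h₁⟩ := h₁
  obtain ⟨rfl, h₂⟩ := h₂
  have h12 : j₁ = j₂ := by simpa using hbu _ _ hs₁ hs₂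
  have hfour := hS.four_le_rail_of_b_middle hodd hn haz (by
    intro j hj
    have : j = ⟨j₁, hj₁⟩ := hbu _ _ hj hs₁
    subst this
    simp only
    omega)
  have hb1 : 1 ≤ kindCount S (· = .b) :=
    list_length_le_kindCount [(.b, ⟨j₁, hj₁⟩)] (by simp) (by simp [hs₁])
  omega

theorem six_le_card : 6 ≤ S.card := by
  obtain ⟨i, hi, hs⟩ := hS.exists_a_mem hodd hn
  obtain ⟨S', hS', h0, hcount⟩ := hS.exists_index_zero hi hs
  have hall : ∀ T : Finset (FlowerKind × Fin n), kindCount T (fun _ => True) = T.card := by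
    simp [kindCount]
  rw [← hall, ← hcount _ (by simp), hall]
  exact hS'.six_le_card_of_a_zero hodd hn h0

end FlowerSnarkSeparates

/-! ### The upper bound -/

/-- The values of the rail and cycle distances from the indices `0`, `m`, `1`, `m + 1` in
`J_{2 m + 1}`. -/
theorem dist_landmark_cases {m i : ℕ} (hm : 2 ≤ m) (hi : i < 2 * m + 1) :
    ∃ e₀ eₘ e₁ e₂ p₁ p₂ q₁ q₂,
      cycleDist (2 * m + 1) 0 i = e₀ ∧ cycleDist (2 * m + 1) m i = eₘ ∧
      cycleDist (2 * m + 1) 1 i = e₁ ∧ cycleDist (2 * m + 1) (m + 1) i = e₂ ∧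
      sameRailDist (2 * m + 1) 1 i = p₁ ∧ sameRailDist (2 * m + 1) (m + 1) i = p₂ ∧
      crossRailDist (2 * m + 1) 1 i = q₁ ∧ crossRailDist (2 * m + 1) (m + 1) i = q₂ ∧
      ((i = 0 ∧ e₀ = 0 ∧ eₘ = m ∧ e₁ = 1 ∧ e₂ = m ∧ p₁ = 1 ∧ p₂ = m + 1 ∧ q₁ = 3 ∧ q₂ = m) ∨
      (i = 1 ∧ e₀ = 1 ∧ eₘ + 1 = m ∧ e₁ = 0 ∧ e₂ = m ∧ p₁ = 0 ∧ p₂ = m ∧ q₁ = 2 ∧ q₂ = m + 1) ∨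
      (2 ≤ i ∧ i ≤ m ∧ e₀ = i ∧ eₘ + i = m ∧ e₁ + 1 = i ∧ e₂ + i = m + 1 ∧ p₁ + 1 = i ∧
        p₂ + i = m + 1 ∧ q₁ = i + 1 ∧ q₂ + i = m + 3) ∨
      (i = m + 1 ∧ e₀ = m ∧ eₘ = 1 ∧ e₁ = m ∧ e₂ = 0 ∧ p₁ = m ∧ p₂ = 0 ∧ q₁ = m + 1 ∧ q₂ = 2) ∨
      (i = m + 2 ∧ e₀ + 1 = m ∧ eₘ = 2 ∧ e₁ = m ∧ e₂ = 1 ∧ p₁ = m + 1 ∧ p₂ = 1 ∧ q₁ = m ∧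
        q₂ = 3) ∨
      (m + 3 ≤ i ∧ i ≤ 2 * m ∧ e₀ + i = 2 * m + 1 ∧ eₘ + m = i ∧ e₁ + i = 2 * m + 2 ∧
        e₂ + m + 1 = i ∧ p₁ + i = 2 * m + 4 ∧ p₂ + m + 1 = i ∧ q₁ + i = 2 * m + 2 ∧
        q₂ + m = i + 1)) := by
  refine ⟨_, _, _, _, _, _, _, _, rfl, rfl, rfl, rfl, rfl, rfl, rfl, rfl, ?_⟩
  obtain h | h | h | h | h | h : i = 0 ∨ i = 1 ∨ (2 ≤ i ∧ i ≤ m) ∨ i = m + 1 ∨ i = m + 2 ∨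
      (m + 3 ≤ i ∧ i ≤ 2 * m) := by omega
  · exact .inl (by unfold cycleDist sameRailDist crossRailDist; omega)
  · exact .inr (.inl (by unfold cycleDist sameRailDist crossRailDist; omega))
  · exact .inr (.inr (.inl (by unfold cycleDist sameRailDist crossRailDist; omega)))
  · exact .inr (.inr (.inr (.inl (by unfold cycleDist sameRailDist crossRailDist; omega))))
  · exact .inr (.inr (.inr (.inr (.inl (by unfold cycleDist sameRailDist crossRailDist; omega)))))
  · exact .inr (.inr (.inr (.inr (.inr (by unfold cycleDist sameRailDist crossRailDist; omega)))))

-- On each of the six index ranges of `dist_landmark_cases` all landmark distances are linear, so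
-- each pair of kinds and ranges is a contradiction in linear arithmetic.
set_option maxHeartbeats 4000000 in
theorem flowerSnark_separated {m : ℕ} (hm : 2 ≤ m) (x y : FlowerKind × Fin (2 * m + 1))
    (hxy : x ≠ y)
    (h : ∀ s ∈ ([(.a, ⟨0, by omega⟩), (.b, ⟨m, by omega⟩), (.c, ⟨1, by omega⟩), (.d, ⟨1, by omega⟩),
      (.c, ⟨m + 1, by omega⟩), (.d, ⟨m + 1, by omega⟩)] : List (FlowerKind × Fin (2 * m + 1))),
      flowerSnarkDist _ s y ≤ flowerSnarkDist _ s x) : False := by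
  obtain ⟨k, i, hi⟩ := x
  obtain ⟨l, j, hj⟩ := y
  simp only [List.forall_mem_cons] at h
  obtain ⟨h1, h2, h3, h4, h5, h6, -⟩ := h
  obtain ⟨e₀, eₘ, e₁, e₂, p₁, p₂, q₁, q₂, hi1, hi2, hi3, hi4, hi5, hi6, hi7, hi8, hicases⟩ :=
    dist_landmark_cases hm hi
  obtain ⟨e₀', eₘ', e₁', e₂', p₁', p₂', q₁', q₂', hj1, hj2, hj3, hj4, hj5, hj6, hj7, hj8, hjcases⟩ :=
    dist_landmark_cases hm hj
  cases k <;> cases l <;>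
    simp only [flowerSnarkDist, ne_eq, Prod.mk.injEq, true_and, Fin.mk.injEq, hi1, hi2, hi3, hi4,
      hi5, hi6, hi7, hi8, hj1, hj2, hj3, hj4, hj5, hj6, hj7, hj8] at h1 h2 h3 h4 h5 h6 hxy <;>
    clear hi1 hi2 hi3 hi4 hi5 hi6 hi7 hi8 hj1 hj2 hj3 hj4 hj5 hj6 hj7 hj8 <;>
    (try split_ifs at h2) <;>
    rcases hicases with H | H | H | H | H | H <;> rcases hjcases with H' | H' | H' | H' | H' | H' <;>
    omega

/-! ### The dimension -/

theorem flowerSnark_isSolidResolving_one_iff {n : ℕ} (hodd : Odd n) (hn : 5 ≤ n)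
    (S : Finset (FlowerKind × Fin n)) :
    (flowerSnark n).IsSolidResolving 1 (S : Set (FlowerKind × Fin n)) ↔
      FlowerSnarkSeparates n S := by
  rw [SimpleGraph.isSolidResolving_one_iff]
  simp only [flowerSnark_edist hodd hn, Nat.cast_lt, Finset.mem_coe]
  refine ⟨fun h => h.2, fun h => ⟨?_, h⟩⟩
  obtain ⟨i, hi, hs⟩ := h.exists_a_mem hodd hn
  exact ⟨_, hs⟩

theorem exists_flowerSnarkSeparates_card_eq_six {n : ℕ} (hodd : Odd n) (hn : 5 ≤ n) :
    ∃ S : Finset (FlowerKind × Fin n), FlowerSnarkSeparates n S ∧ S.card = 6 := by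
  obtain ⟨m, rfl⟩ := hodd
  refine ⟨List.toFinset [(.a, ⟨0, by omega⟩), (.b, ⟨m, by omega⟩), (.c, ⟨1, by omega⟩),
    (.d, ⟨1, by omega⟩), (.c, ⟨m + 1, by omega⟩), (.d, ⟨m + 1, by omega⟩)], ?_, ?_⟩
  · intro x y hxy
    by_contra! h
    exact flowerSnark_separated (by omega) x y hxy fun s hs => h s (List.mem_toFinset.mpr hs)
  · rw [List.toFinset_card_of_nodup]
    · rfl
    · simp
      omega

/-- The 1-solid-metric dimension of every flower snark `J_n`, `n ≥ 5` odd, equals `6`. -/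
theorem mainTheorem1 (n : ℕ) (hodd : Odd n) (hn : 5 ≤ n) :
    (flowerSnark n).solidMetricDim 1 = 6 := by
  apply le_antisymm
  · obtain ⟨S, hS, hcard⟩ := exists_flowerSnarkSeparates_card_eq_six hodd hn
    refine (iInf₂_le (S : Set _) ((flowerSnark_isSolidResolving_one_iff hodd hn S).mpr hS)).trans ?_
    rw [Set.encard_coe_eq_coe_finsetCard, hcard]
    rfl
  · refine le_iInf₂ fun S hS => ?_
    lift S to Finset (FlowerKind × Fin n) using S.toFinite
    have := ((flowerSnark_isSolidResolving_one_iff hodd hn S).mp hS).six_le_card hodd hn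
    rw [Set.encard_coe_eq_coe_finsetCard]
    exact_mod_cast this
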